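/- Let $n\ge 1$ and $m\ge 0$ be integers. The Yoke graph $Y_{n,m}$ is the simple graph whose vertices are all sequences $v=(v_0,v_1,\dots,v_m,v_{m+1})$ with $v_0,v_{m+1}\in\mathbb{Z}/n\mathbb{Z}$, $v_1,\dots,v_m\in\{0,1\}$ and $\sum_{i=0}^{m+1}v_i\equiv 0\pmod n$. Two distinct vertices $u,v$ are adjacent if there is $0\le i\le m$ such that $u_j=v_j$ for every $j\notin\{i,i+1\}$ and either $u_i=v_i+1$ and $u_{i+1}=v_{i+1}-1$, or $u_i=v_i-1$ and $u_{i+1}=v_{i+1}+1$; here the equations for the entries $0$ and $m+1$ are in $\mathbb{Z}/n\mathbb{Z}$ and those for the entries $1,\dots,m$ are in $\mathbb{Z}$. The diameter $\operatorname{diam}(G)$ of a connected finite graph $G$ is the maximal distance between two of its vertices. Then $Y_{n,m}$ is connected, and its diameter is as follows. 1. If $n=1$, then $\operatorname{diam}(Y_{n,m})=\binom{\lceil m/2\rceil+1}{2}+\binom{\lfloor m/2\rfloor+1}{2}$. 2. If $0\le m\le n$, then $\operatorname{diam}(Y_{n,m})=\left\lfloor\frac{n(m+1)}{2}\right\rfloor$.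 3. If $2\le n\le m$, let $d_0=\binom{\lfloor (m+n)/2\rfloor+1}{2}+\binom{\lceil (m-n)/2\rceil+1}{2}$. Then (a) if $2\mid (m-n)$ or $n\le\lceil\frac{m+1}{2}\rceil$, then $\operatorname{diam}(Y_{n,m})=d_0$; (b) otherwise, $\operatorname{diam}(Y_{n,m})=d_0+n-\lceil\frac{m+1}{2}\rceil$. -/

import Mathlib

/-- A vertex of the Yoke graph `Y_{n,m}`: a sequence `(v₀, v₁, …, v_m, v_{m+1})` with
`v₀, v_{m+1} ∈ ℤ/n` (the buckets `left` and `right`) and `v₁, …, v_m ∈ {0, 1}`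
(`mid k` is `v_{k+1}`), whose sum is `0` modulo `n`. -/
@[ext]
structure YokeVertex (n m : ℕ) where
  left : ZMod n
  mid : Fin m → Fin 2
  right : ZMod n
  sum_eq_zero : left + ∑ k, ((mid k : ℕ) : ZMod n) + right = 0

/-- The relation `u_j = v_j + d` for the entry with index `j ∈ {0, …, m+1}`: an equation in `ℤ/n`
for the two buckets `j = 0` and `j = m + 1`, and an equation in `ℤ` for the entries between. -/
def YokeVertex.EntryEqAdd {n m : ℕ} (u v : YokeVertex n m) (j : ℕ) (d : ℤ) : Prop :=
  (j = 0 → u.left = v.left + (d : ZMod n)) ∧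
  (∀ k : Fin m, j = (k : ℕ) + 1 → ((u.mid k : ℕ) : ℤ) = ((v.mid k : ℕ) : ℤ) + d) ∧
  (j = m + 1 → u.right = v.right + (d : ZMod n))

/-- Shifting a unit between the entries `i` and `i + 1` (to the left or to the right) of `v`
gives `u`; all other entries agree. -/
def YokeVertex.IsShift {n m : ℕ} (u v : YokeVertex n m) (i : ℕ) : Prop :=
  (∀ j : ℕ, j ≤ m + 1 → j ≠ i → j ≠ i + 1 → u.EntryEqAdd v j 0) ∧
  ((u.EntryEqAdd v i 1 ∧ u.EntryEqAdd v (i + 1) (-1)) ∨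
    (u.EntryEqAdd v i (-1) ∧ u.EntryEqAdd v (i + 1) 1))

/-- The Yoke graph `Y_{n,m}`. The condition `u ≠ v` only matters for `n = 1`, `m = 0`, where the
unique vertex would otherwise carry a loop; the graph is simple. -/
def yokeGraph (n m : ℕ) : SimpleGraph (YokeVertex n m) where
  Adj u v := u ≠ v ∧ ∃ i : ℕ, i ≤ m ∧ u.IsShift v i
  symm := ⟨by
    have key : ∀ (u v : YokeVertex n m) (j : ℕ) (d e : ℤ), d + e = 0 →
        u.EntryEqAdd v j d → v.EntryEqAdd u j e := by
      rintro u v j d e hde ⟨h1, h2, h3⟩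
      have hde' : (d : ZMod n) + (e : ZMod n) = 0 := by
        rw [← Int.cast_add, hde, Int.cast_zero]
      refine ⟨fun h => ?_, fun k hk => ?_, fun h => ?_⟩
      · rw [h1 h, add_assoc, hde', add_zero]
      · have := h2 k hk
        omega
      · rw [h3 h, add_assoc, hde', add_zero]
    rintro u v ⟨hne, i, hi, h0, h⟩
    refine ⟨hne.symm, i, hi, fun j hj hji hji' => key _ _ _ _ _ (by norm_num) (h0 j hj hji hji'), ?_⟩
    rcases h with ⟨ha, hb⟩ | ⟨ha, hb⟩
    · exact Or.inr ⟨key _ _ _ _ _ (by norm_num) ha, key _ _ _ _ _ (by norm_num) hb⟩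
    · exact Or.inl ⟨key _ _ _ _ _ (by norm_num) ha, key _ _ _ _ _ (by norm_num) hb⟩⟩
  loopless := ⟨fun _ h => h.1 rfl⟩

/-!
Lift the partial sums of a vertex to `ℤ`: this gives a sequence `s 0, …, s m` that moves by `0` or
`1` at each step, unique up to adding a constant multiple of `n`. An edge of the graph changes one
term of a lift by `±1`, and any two such sequences `s`, `t` can be joined by `∑ |s i - t i|` changes
of this kind. Hence the distance between two vertices with lifts `s` and `t` is the minimum over
`k : ℤ` of `∑ |d i - k n|`, where `d = s - t`; and the differences `d` are exactly the sequences
whose steps are at most `1` in absolute value.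

To bound this minimum, write `m = a + b` with `b ≤ a`. If `d` takes a multiple of `n` as a value at
some index in `[b, a]`, comparison with `|i - b|` bounds the sum for this multiple by
`C(a + 1, 2) + C(b + 1, 2)`. Otherwise `d` stays strictly between two consecutive multiples of `n`
on `[b, a]`, and the sums for these two multiples add up to at most `n (m + 1) + 4 C(b, 2)`. The
extremal sequences stay near `n / 2` when `m ≤ n`, and are the ramp from `-b` to `a`, possibly with
the value `⌊n / 2⌋` repeated, when `n ≤ m`.
-/

open Finset

/-- The integer sequence `s 0, …, s m` moves by `0` or `1` at each step: the partial sums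
`v₀, v₀ + v₁, …, v₀ + ⋯ + v_m` of a Yoke vertex, with `v₀` lifted to `ℤ`. Values of `s` beyond `m`
are irrelevant. -/
def IsStaircase (m : ℕ) (s : ℕ → ℤ) : Prop :=
  ∀ i < m, s (i + 1) = s i ∨ s (i + 1) = s i + 1

/-- The integer sequence `d 0, …, d m` moves by at most `1` at each step: the difference of two
staircases. Values of `d` beyond `m` are irrelevant. -/
def HasUnitSteps (m : ℕ) (d : ℕ → ℤ) : Prop :=
  ∀ i < m, (d (i + 1) - d i).natAbs ≤ 1

theorem IsStaircase.hasUnitSteps_sub {m : ℕ} {s t : ℕ → ℤ} (hs : IsStaircase m s)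
    (ht : IsStaircase m t) : HasUnitSteps m (s - t) := by
  intro i hi
  have hsi := hs i hi
  have hti := ht i hi
  simp only [Pi.sub_apply]
  omega

theorem HasUnitSteps.exists_isStaircase_sub_eq {m : ℕ} {d : ℕ → ℤ} (hd : HasUnitSteps m d) :
    ∃ s t : ℕ → ℤ, IsStaircase m s ∧ IsStaircase m t ∧ s - t = d := by
  let t : ℕ → ℤ := fun i => ∑ j ∈ range i, max 0 (d j - d (j + 1))
  have ht : ∀ i, t (i + 1) = t i + max 0 (d i - d (i + 1)) := fun i => sum_range_succ _ i
  refine ⟨d + t, t, fun i hi => ?_, fun i hi => ?_, add_sub_cancel_right d t⟩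
  all_goals
    have hdi := hd i hi
    simp only [Pi.add_apply, ht]
    omega

/-- The potential `2 s i - i` grows when moving left along a flat step of `s` or right along a rise,
and both moves preserve `t i < s i`. Where it is maximal, `s` therefore rises into `i` and is flat
after it, so `s i` can be lowered. -/
theorem IsStaircase.exists_sub_single {m : ℕ} {s t : ℕ → ℤ} (hs : IsStaircase m s)
    (ht : IsStaircase m t) (hlt : ∃ i ≤ m, t i < s i) :
    ∃ i ≤ m, t i < s i ∧ IsStaircase m (s - Pi.single i 1) := by
  obtain ⟨i₀, hi₀, hlt₀⟩ := hlt
  obtain ⟨i, hi, hmax⟩ := exists_max_image {i ∈ range (m + 1) | t i < s i} (fun i => 2 * s i - i)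
    ⟨i₀, by simp only [mem_filter, mem_range]; omega⟩
  simp only [mem_filter, mem_range] at hi hmax
  refine ⟨i, by omega, hi.2, fun j hj => ?_⟩
  have hsj := hs j hj
  have htj := ht j hj
  have hmax_left := hmax j
  have hmax_right := hmax (j + 1)
  push_cast at hmax_right
  simp only [Pi.sub_apply, Pi.single_apply]
  rcases eq_or_ne j i with rfl | hji
  · simp only [Nat.succ_ne_self, if_true, if_false]
    omega
  · rcases eq_or_ne (j + 1) i with rfl | hji'
    · simp only [if_true, hji, if_false]
      push_cast at hmax_left
      omega
    · simpa only [hji, hji', if_false, sub_zero] using hsj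

theorem sum_natAbs_sub_single {m i : ℕ} {s t : ℕ → ℤ} (hi : i ≤ m) (hlt : t i < s i) :
    ∑ j ∈ range (m + 1), ((s - Pi.single i 1 : ℕ → ℤ) j - t j).natAbs + 1 =
      ∑ j ∈ range (m + 1), (s j - t j).natAbs := by
  have hmem : i ∈ range (m + 1) := mem_range.2 (by omega)
  rw [← add_sum_erase _ _ hmem, ← add_sum_erase (range (m + 1)) _ hmem, add_right_comm]
  congr 1
  · simp only [Pi.sub_apply, Pi.single_eq_same]
    omega
  · refine sum_congr rfl fun j hj => ?_
    rw [Pi.sub_apply, Pi.single_eq_of_ne (ne_of_mem_erase hj), sub_zero]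

theorem sum_cast_eq_sub_of_increments {R : Type*} [Ring R] {m : ℕ} {s : ℕ → ℤ} {f : Fin m → ℕ}
    (hf : ∀ k : Fin m, s (k + 1) = s k + f k) : ∑ k, (f k : R) = s m - s 0 := by
  rw [← sum_range_sub (fun i => (s i : R)) m, sum_range]
  exact sum_congr rfl fun k _ => by rw [hf k, Int.cast_add, add_sub_cancel_left, Int.cast_natCast]

namespace YokeVertex

variable {n m : ℕ} {u v : YokeVertex n m} {s t : ℕ → ℤ}

/-- `s 0, …, s m` is a lift to `ℤ` of the partial sums of `u`: its initial value represents the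
left bucket and its increments are the entries `u₁, …, u_m`. Values of `s` beyond `m` are
irrelevant, and the right bucket is determined by `s m`. -/
def IsLift (u : YokeVertex n m) (s : ℕ → ℤ) : Prop :=
  (s 0 : ZMod n) = u.left ∧ ∀ k : Fin m, s (k + 1) = s k + (u.mid k : ℕ)

theorem IsLift.right_eq (hu : u.IsLift s) : u.right = -(s m : ZMod n) := by
  linear_combination u.sum_eq_zero - sum_cast_eq_sub_of_increments (R := ZMod n) hu.2 + hu.1

theorem IsLift.isStaircase (hu : u.IsLift s) : IsStaircase m s := by
  intro i hi
  have hstep := hu.2 ⟨i, hi⟩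
  dsimp only at hstep
  omega

theorem exists_isLift (u : YokeVertex n m) : ∃ s, u.IsLift s := by
  obtain ⟨z, hz⟩ := ZMod.intCast_surjective u.left
  refine ⟨fun i => z + ∑ j ∈ range i, if h : j < m then ((u.mid ⟨j, h⟩ : ℕ) : ℤ) else 0,
    by simpa using hz, fun k => ?_⟩
  simp [sum_range_succ, add_assoc]

theorem exists_isLift_of_isStaircase (n : ℕ) (hs : IsStaircase m s) :
    ∃ u : YokeVertex n m, u.IsLift s := by
  let bit : Fin m → Fin 2 := fun k => if s (k + 1) = s k then 0 else 1
  have hbit : ∀ k : Fin m, s (k + 1) = s k + (bit k : ℕ) := by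
    intro k
    by_cases hflat : s (k + 1) = s k
    · simp [bit, hflat]
    · simpa [bit, hflat] using (hs k k.isLt).resolve_left hflat
  exact ⟨⟨s 0, bit, -(s m : ZMod n), by rw [sum_cast_eq_sub_of_increments hbit]; ring⟩, rfl, hbit⟩

instance : Nonempty (YokeVertex n m) :=
  (exists_isLift_of_isStaircase n (s := 0) fun _ _ => Or.inl rfl).nonempty

theorem IsLift.eq (hu : u.IsLift s) (hv : v.IsLift t) (hst : ∀ i ≤ m, s i = t i) : u = v := by
  ext k
  · rw [← hu.1, ← hv.1, hst 0 (Nat.zero_le m)]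
  · have huk := hu.2 k
    have hvk := hv.2 k
    rw [hst _ k.isLt.le, hst (k + 1) k.isLt] at huk
    omega
  · rw [hu.right_eq, hv.right_eq, hst m le_rfl]

theorem IsLift.add_mul (hu : u.IsLift s) (k : ℤ) : u.IsLift fun i => s i + k * n :=
  ⟨by simpa using hu.1, fun j => by simp only [hu.2 j, add_right_comm]⟩

theorem IsLift.exists_eq_add_mul (hs : u.IsLift s) (ht : u.IsLift t) :
    ∃ k : ℤ, ∀ i ≤ m, s i = t i + k * n := by
  obtain ⟨k, hk⟩ := (ZMod.intCast_eq_intCast_iff_dvd_sub (t 0) (s 0) n).1 (ht.1.trans hs.1.symm)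
  refine ⟨k, fun i => ?_⟩
  induction i with
  | zero => intro _; linear_combination hk
  | succ i ih =>
    intro hi
    linear_combination hs.2 ⟨i, hi⟩ - ht.2 ⟨i, hi⟩ + ih (by omega)

theorem isShift_iff {i : ℕ} (hi : i ≤ m) :
    u.IsShift v i ↔ ∃ e : ℤ, e.natAbs = 1 ∧
      ∀ j ≤ m + 1, u.EntryEqAdd v j ((Pi.single i e - Pi.single (i + 1) e : ℕ → ℤ) j) := by
  have hpulse (e : ℤ) :
      (∀ j ≤ m + 1, u.EntryEqAdd v j ((Pi.single i e - Pi.single (i + 1) e : ℕ → ℤ) j)) ↔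
        (∀ j ≤ m + 1, j ≠ i → j ≠ i + 1 → u.EntryEqAdd v j 0) ∧
          u.EntryEqAdd v i e ∧ u.EntryEqAdd v (i + 1) (-e) := by
    simp only [Pi.sub_apply, Pi.single_apply]
    refine ⟨fun h => ⟨fun j hj hji hji' => ?_, ?_, ?_⟩, fun ⟨hrest, hleft, hright⟩ j hj => ?_⟩
    · simpa [hji, hji'] using h j hj
    · simpa using h i (by omega)
    · simpa using h (i + 1) (by omega)
    · rcases eq_or_ne j i with rfl | hji
      · simpa using hleft
      · rcases eq_or_ne j (i + 1) with rfl | hji'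
        · simpa using hright
        · simpa [hji, hji'] using hrest j hj hji hji'
  simp only [hpulse, Int.natAbs_eq_iff, Nat.cast_one, or_and_right, exists_or, exists_eq_left,
    neg_neg, ← and_or_left, IsShift]

theorem IsLift.isShift_iff (hu : u.IsLift s) {i : ℕ} (hi : i ≤ m) :
    u.IsShift v i ↔ ∃ e : ℤ, e.natAbs = 1 ∧ v.IsLift (s - Pi.single i e) := by
  rw [YokeVertex.isShift_iff hi]
  refine exists_congr fun e => and_congr_right fun _ => ⟨fun h => ⟨?_, fun k => ?_⟩,
    fun hv j hj => ⟨?_, ?_, ?_⟩⟩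
  · have hleft := (h 0 (by omega)).1 rfl
    simp only [Pi.sub_apply, Pi.single_apply, (Nat.succ_ne_zero i).symm, if_false, sub_zero]
      at hleft ⊢
    rw [Int.cast_sub, hu.1, hleft, add_sub_cancel_right]
  · have hmid := (h (k + 1) (by omega)).2.1 k rfl
    simp only [Pi.sub_apply, Pi.single_apply, Nat.add_right_cancel_iff] at hmid ⊢
    linarith [hu.2 k]
  · rintro rfl
    have hleft := hv.1
    simp only [Pi.sub_apply, Pi.single_apply, (Nat.succ_ne_zero i).symm, if_false, sub_zero]
      at hleft ⊢
    rw [← hleft, ← hu.1, Int.cast_sub, sub_add_cancel]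
  · rintro k rfl
    have hmid := hv.2 k
    simp only [Pi.sub_apply, Pi.single_apply, Nat.add_right_cancel_iff] at hmid ⊢
    linarith [hu.2 k]
  · rintro rfl
    have hne : m + 1 ≠ i := by omega
    rw [hu.right_eq, hv.right_eq]
    simp only [Pi.sub_apply, Pi.single_apply, Nat.add_right_cancel_iff, hne, if_false]
    push_cast
    ring

theorem IsLift.edist_le_one (hu : u.IsLift s) {i : ℕ} (hi : i ≤ m)
    (hv : v.IsLift (s - Pi.single i 1)) : (yokeGraph n m).edist u v ≤ 1 := by
  have hshift : u.IsShift v i := (hu.isShift_iff hi).2 ⟨1, rfl, hv⟩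
  rw [SimpleGraph.edist_le_one_iff_adj_or_eq]
  exact (ne_or_eq u v).imp_left fun hne => ⟨hne, i, hi, hshift⟩

theorem IsLift.exists_isLift_of_adj (hu : u.IsLift s) (huv : (yokeGraph n m).Adj u v) :
    ∃ t, v.IsLift t ∧ ∑ j ∈ range (m + 1), (s j - t j).natAbs = 1 := by
  obtain ⟨-, i, hi, hshift⟩ := huv
  obtain ⟨e, he, hv⟩ := (hu.isShift_iff hi).1 hshift
  refine ⟨_, hv, ?_⟩
  rw [sum_eq_single_of_mem i (mem_range.2 (by omega)) fun j _ hj => by simp [hj]]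
  simpa using he

theorem IsLift.exists_isLift_of_walk (hu : u.IsLift s) (p : (yokeGraph n m).Walk u v) :
    ∃ t, v.IsLift t ∧ ∑ j ∈ range (m + 1), (s j - t j).natAbs ≤ p.length := by
  induction p generalizing s with
  | nil => exact ⟨s, hu, by simp⟩
  | cons huw p ih =>
    obtain ⟨r, hr, hsr⟩ := hu.exists_isLift_of_adj huw
    obtain ⟨t, ht, hrt⟩ := ih hr
    refine ⟨t, ht, ?_⟩
    calc ∑ j ∈ range (m + 1), (s j - t j).natAbs
        ≤ ∑ j ∈ range (m + 1), ((s j - r j).natAbs + (r j - t j).natAbs) :=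
          sum_le_sum fun j _ => by omega
      _ ≤ (SimpleGraph.Walk.cons huw p).length := by
          rw [sum_add_distrib, hsr, SimpleGraph.Walk.length_cons, add_comm]
          exact Nat.add_le_add_right hrt 1

theorem IsLift.edist_le (hu : u.IsLift s) (hv : v.IsLift t) :
    (yokeGraph n m).edist u v ≤ (∑ j ∈ range (m + 1), (s j - t j).natAbs : ℕ) := by
  obtain ⟨N, hN⟩ : ∃ N, ∑ j ∈ range (m + 1), (s j - t j).natAbs = N := ⟨_, rfl⟩
  rw [hN]
  induction N generalizing u v s t with
  | zero =>
    obtain rfl : u = v := hu.eq hv fun i hi => by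
      have := sum_eq_zero_iff.1 hN i (mem_range.2 (by omega))
      omega
    exact SimpleGraph.edist_self.le
  | succ N ih =>
    obtain ⟨i, hi, hne⟩ := exists_ne_zero_of_sum_ne_zero (hN.trans_ne N.succ_ne_zero)
    wlog hlt : t i < s i generalizing u v s t
    · rw [SimpleGraph.edist_comm]
      exact this hv hu (by simpa only [← Int.natAbs_neg (s _ - _), neg_sub] using hN)
        (by omega) (by omega)
    obtain ⟨j, hj, hjlt, hlow⟩ := hu.isStaircase.exists_sub_single hv.isStaircase
      ⟨i, Nat.lt_succ_iff.1 (mem_range.1 hi), hlt⟩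
    obtain ⟨w, hw⟩ := exists_isLift_of_isStaircase n hlow
    have hwv := ih hw hv (by have := sum_natAbs_sub_single hj hjlt; omega)
    calc (yokeGraph n m).edist u v
        ≤ (yokeGraph n m).edist u w + (yokeGraph n m).edist w v := SimpleGraph.edist_triangle
      _ ≤ 1 + N := add_le_add (hu.edist_le_one hj hw) hwv
      _ = (N + 1 : ℕ) := by rw [add_comm, Nat.cast_succ]

theorem IsLift.edist_le_iff (hu : u.IsLift s) (hv : v.IsLift t) {D : ℕ} :
    (yokeGraph n m).edist u v ≤ D ↔
      ∃ k : ℤ, ∑ j ∈ range (m + 1), ((s - t) j - k * n).natAbs ≤ D := by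
  constructor
  · intro hD
    obtain ⟨p, hp⟩ := SimpleGraph.exists_walk_of_edist_ne_top
      (ne_top_of_le_ne_top (ENat.natCast_ne_top D) hD)
    obtain ⟨r, hr, hsr⟩ := hu.exists_isLift_of_walk p
    obtain ⟨k, hk⟩ := hr.exists_eq_add_mul hv
    have hpD : p.length ≤ D := by exact_mod_cast hp.trans_le hD
    refine ⟨k, (sum_congr rfl fun j hj => ?_).trans_le (hsr.trans hpD)⟩
    rw [hk j (Nat.lt_succ_iff.1 (mem_range.1 hj)), Pi.sub_apply, sub_sub]
  · rintro ⟨k, hk⟩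
    refine (hu.edist_le (hv.add_mul k)).trans ?_
    simpa only [Pi.sub_apply, sub_sub, Nat.cast_le] using hk

end YokeVertex

namespace yokeGraph

theorem connected (n m : ℕ) : (yokeGraph n m).Connected where
  preconnected u v := by
    obtain ⟨s, hs⟩ := u.exists_isLift
    obtain ⟨t, ht⟩ := v.exists_isLift
    exact SimpleGraph.reachable_of_edist_ne_top
      (ne_top_of_le_ne_top (ENat.natCast_ne_top _) (hs.edist_le ht))

theorem ediam_le_iff {n m D : ℕ} :
    (yokeGraph n m).ediam ≤ D ↔ ∀ d, HasUnitSteps m d →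
      ∃ k : ℤ, ∑ i ∈ range (m + 1), (d i - k * n).natAbs ≤ D := by
  rw [SimpleGraph.ediam_le_iff]
  constructor
  · intro hD d hd
    obtain ⟨s, t, hs, ht, rfl⟩ := hd.exists_isStaircase_sub_eq
    obtain ⟨u, hu⟩ := YokeVertex.exists_isLift_of_isStaircase n hs
    obtain ⟨v, hv⟩ := YokeVertex.exists_isLift_of_isStaircase n ht
    exact (hu.edist_le_iff hv).1 (hD u v)
  · intro hD u v
    obtain ⟨s, hs⟩ := u.exists_isLift
    obtain ⟨t, ht⟩ := v.exists_isLift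
    exact (hs.edist_le_iff ht).2 (hD _ (hs.isStaircase.hasUnitSteps_sub ht.isStaircase))

theorem diam_eq {n m D : ℕ} (hle : ∀ d, HasUnitSteps m d →
      ∃ k : ℤ, ∑ i ∈ range (m + 1), (d i - k * n).natAbs ≤ D)
    {d : ℕ → ℤ} (hd : HasUnitSteps m d)
    (hge : ∀ k : ℤ, D ≤ ∑ i ∈ range (m + 1), (d i - k * n).natAbs) :
    (yokeGraph n m).diam = D := by
  have hediam_le : (yokeGraph n m).ediam ≤ D := ediam_le_iff.2 hle
  obtain ⟨E, hE⟩ := ENat.ne_top_iff_exists.1 (ne_top_of_le_ne_top (ENat.natCast_ne_top D) hediam_le)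
  obtain ⟨k, hk⟩ := ediam_le_iff.1 hE.ge d hd
  have hED : E ≤ D := by exact_mod_cast hE.trans_le hediam_le
  rw [SimpleGraph.diam, ← hE, ENat.toNat_natCast]
  exact le_antisymm hED ((hge k).trans hk)

end yokeGraph

theorem two_mul_choose_two (a : ℕ) : 2 * (a.choose 2 : ℤ) = a * (a - 1) := by
  apply Int.cast_injective (α := ℚ)
  push_cast
  rw [Nat.cast_choose_two]
  ring

theorem choose_two_succ (a : ℕ) : (a + 1).choose 2 = a + a.choose 2 := by
  rw [Nat.choose_succ_succ' a 1, Nat.choose_one_right]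

theorem sum_range_id_eq_choose (a : ℕ) : ∑ i ∈ range a, i = a.choose 2 := by
  rw [sum_range_id, Nat.choose_two_right]

/-- Pairing `i` with `m - i` shows that the sum of `|i - c|` over `0 ≤ i ≤ m` depends only on the
distance from `c` to `m / 2`, and monotonically so. -/
theorem two_mul_sum_natAbs_sub (m : ℕ) (c : ℤ) :
    2 * ∑ i ∈ range (m + 1), ((i : ℤ) - c).natAbs =
      ∑ i ∈ range (m + 1), max (m - 2 * c).natAbs ((m : ℤ) - 2 * i).natAbs := by
  rw [two_mul]
  nth_rw 1 [← sum_range_reflect]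
  rw [← sum_add_distrib]
  refine sum_congr rfl fun i hi => ?_
  have hi' := mem_range.1 hi
  omega

theorem sum_natAbs_sub_le_sum_natAbs_sub {m : ℕ} {c c' : ℤ}
    (h : (m - 2 * c).natAbs ≤ (m - 2 * c').natAbs) :
    ∑ i ∈ range (m + 1), ((i : ℤ) - c).natAbs ≤ ∑ i ∈ range (m + 1), ((i : ℤ) - c').natAbs := by
  rw [← Nat.mul_le_mul_left_iff two_pos, two_mul_sum_natAbs_sub, two_mul_sum_natAbs_sub]
  exact sum_le_sum fun i _ => max_le_max_right _ h

theorem sum_natAbs_sub_natCast (a b : ℕ) :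
    ∑ i ∈ range (a + b + 1), ((i : ℤ) - b).natAbs = (a + 1).choose 2 + (b + 1).choose 2 := by
  have hbelow : ∑ i ∈ range b, ((i : ℤ) - b).natAbs = (b + 1).choose 2 := by
    rw [← sum_range_id_eq_choose, sum_range_succ', add_zero, ← sum_range_reflect]
    refine sum_congr rfl fun i hi => ?_
    have hi' := mem_range.1 hi
    omega
  have habove : ∑ i ∈ range (a + 1), (((b + i : ℕ) : ℤ) - b).natAbs = (a + 1).choose 2 := by
    rw [← sum_range_id_eq_choose]
    exact sum_congr rfl fun i _ => by omega
  rw [show a + b + 1 = b + (a + 1) by ring, sum_range_add, hbelow, habove, add_comm]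

theorem sum_tsub_add_tsub (a b : ℕ) :
    ∑ i ∈ range (a + b + 1), ((b - 1 - i) + (i - (a + 1))) = 2 * b.choose 2 := by
  have hfirst : ∑ i ∈ range (b + (a + 1)), (b - 1 - i) = b.choose 2 := by
    rw [sum_range_add, sum_range_reflect (fun i => i) b, ← sum_range_id_eq_choose]
    exact add_eq_left.2 (sum_eq_zero fun i _ => by omega)
  have hlast : ∑ i ∈ range (a + 1 + b), (i - (a + 1)) = b.choose 2 := by
    rw [sum_range_add, ← sum_range_id_eq_choose]
    simp only [Nat.add_sub_cancel_left]
    exact add_eq_right.2 (sum_eq_zero fun i hi => Nat.sub_eq_zero_of_le (mem_range.1 hi).le)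
  rw [sum_add_distrib, two_mul]
  congr 1
  · rw [← hfirst, add_assoc, add_left_comm]
  · rw [← hlast, add_right_comm]

namespace HasUnitSteps

variable {m n a b : ℕ} {d : ℕ → ℤ}

theorem natAbs_sub_le (hd : HasUnitSteps m d) {i j : ℕ} (hi : i ≤ m) (hj : j ≤ m) :
    (d i - d j).natAbs ≤ ((i : ℤ) - j).natAbs := by
  wlog hij : i ≤ j generalizing i j
  · rw [← Int.natAbs_neg, neg_sub, ← Int.natAbs_neg (i - j), neg_sub]
    exact this hj hi (by omega)
  induction j, hij using Nat.le_induction with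
  | base => simp
  | succ j hij ih =>
    have hprev := ih (by omega)
    have hstep := hd j (by omega)
    omega

theorem exists_forall_between (hd : HasUnitSteps a d) (hn : 1 ≤ n) (hab : b ≤ a)
    (hmiss : ∀ j, b ≤ j → j ≤ a → ∀ k : ℤ, d j ≠ k * n) :
    ∃ q : ℤ, ∀ j, b ≤ j → j ≤ a → q * n < d j ∧ d j < q * n + n := by
  refine ⟨d b / n, fun j hj => ?_⟩
  induction j, hj using Nat.le_induction with
  | base =>
    intro _
    have hlow := Int.ediv_mul_le (d b) (b := (n : ℤ)) (by omega)
    have hhigh := Int.lt_ediv_add_one_mul_self (d b) (b := (n : ℤ)) (by omega)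
    exact ⟨hlow.lt_of_ne (hmiss b le_rfl hab _).symm, by rwa [add_one_mul] at hhigh⟩
  | succ j hj ih =>
    intro hja
    have hprev := ih (by omega)
    have hstep := hd j (by omega)
    have hne_low := hmiss (j + 1) (by omega) hja (d b / n)
    have hne_high := hmiss (j + 1) (by omega) hja (d b / n + 1)
    rw [add_one_mul] at hne_high
    omega

theorem sum_natAbs_sub_le_of_mem (hd : HasUnitSteps (a + b) d) {j : ℕ} (hbj : b ≤ j)
    (hja : j ≤ a) :
    ∑ i ∈ range (a + b + 1), (d i - d j).natAbs ≤ (a + 1).choose 2 + (b + 1).choose 2 :=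
  calc ∑ i ∈ range (a + b + 1), (d i - d j).natAbs
      ≤ ∑ i ∈ range (a + b + 1), ((i : ℤ) - j).natAbs := sum_le_sum fun i hi =>
        hd.natAbs_sub_le (Nat.lt_succ_iff.1 (mem_range.1 hi)) (by omega)
    _ ≤ ∑ i ∈ range (a + b + 1), ((i : ℤ) - b).natAbs :=
        sum_natAbs_sub_le_sum_natAbs_sub (by omega)
    _ = (a + 1).choose 2 + (b + 1).choose 2 := sum_natAbs_sub_natCast a b

/-- On `[b, a]` the distances to `y` and `y + n` add up to `n`; outside, `d` leaves the strip by at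
most the number of steps taken minus one. -/
theorem sum_natAbs_sub_add_sum_natAbs_sub_le (hd : HasUnitSteps (a + b) d) (hab : b ≤ a) {y : ℤ}
    (hy : ∀ j, b ≤ j → j ≤ a → y < d j ∧ d j < y + n) :
    ∑ i ∈ range (a + b + 1), (d i - y).natAbs + ∑ i ∈ range (a + b + 1), (d i - (y + n)).natAbs ≤
      n * (a + b + 1) + 4 * b.choose 2 := by
  have hpoint : ∀ i ∈ range (a + b + 1), (d i - y).natAbs + (d i - (y + n)).natAbs ≤
      n + 2 * ((b - 1 - i) + (i - (a + 1))) := by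
    intro i hi
    have him : i ≤ a + b := Nat.lt_succ_iff.1 (mem_range.1 hi)
    have hb := hy b le_rfl hab
    have ha := hy a hab le_rfl
    have hib := hd.natAbs_sub_le him (show b ≤ a + b by omega)
    have hia := hd.natAbs_sub_le him (show a ≤ a + b by omega)
    have hyi := hy i
    omega
  rw [← sum_add_distrib]
  refine (sum_le_sum hpoint).trans_eq ?_
  rw [sum_add_distrib, ← mul_sum, sum_tsub_add_tsub, sum_const, card_range, smul_eq_mul]
  ring

theorem exists_sum_natAbs_sub_le (hd : HasUnitSteps (a + b) d) (hn : 1 ≤ n) (hab : b ≤ a) {D : ℕ}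
    (hhit : (a + 1).choose 2 + (b + 1).choose 2 ≤ D)
    (hmiss : n * (a + b + 1) + 4 * b.choose 2 ≤ 2 * D + 1) :
    ∃ k : ℤ, ∑ i ∈ range (a + b + 1), (d i - k * n).natAbs ≤ D := by
  by_cases hex : ∃ j, b ≤ j ∧ j ≤ a ∧ ∃ k : ℤ, d j = k * n
  · obtain ⟨j, hbj, hja, k, hk⟩ := hex
    exact ⟨k, hk ▸ (hd.sum_natAbs_sub_le_of_mem hbj hja).trans hhit⟩
  · push Not at hex
    have hd_left : HasUnitSteps a d := fun i hi => hd i (by omega)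
    obtain ⟨q, hq⟩ := hd_left.exists_forall_between hn hab hex
    have hsum := hd.sum_natAbs_sub_add_sum_natAbs_sub_le hab hq
    rw [← add_one_mul] at hsum
    by_contra! hlt
    have hlt_low := hlt q
    have hlt_high := hlt (q + 1)
    omega

end HasUnitSteps

theorem le_natAbs_sub_mul_or (n : ℕ) (k : ℤ) :
    (∀ x : ℤ, x ≤ (x - k * n).natAbs) ∨ ∀ x : ℤ, n - x ≤ (x - k * n).natAbs := by
  rcases le_or_gt k 0 with hk | hk
  · have : k * (n : ℤ) ≤ 0 := mul_nonpos_of_nonpos_of_nonneg hk (by omega)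
    exact Or.inl fun x => by omega
  · have : (n : ℤ) ≤ k * n := le_mul_of_one_le_left (by omega) hk
    exact Or.inr fun x => by omega

theorem le_sum_natAbs_sub_mul {ι : Type*} {S : Finset ι} {d : ι → ℤ} {n D : ℕ}
    (hlow : (D : ℤ) ≤ ∑ i ∈ S, d i) (hhigh : (D : ℤ) ≤ ∑ i ∈ S, (n - d i)) (k : ℤ) :
    D ≤ ∑ i ∈ S, (d i - k * n).natAbs := by
  rw [← Nat.cast_le (α := ℤ), Nat.cast_sum]
  rcases le_natAbs_sub_mul_or n k with h | h
  · exact hlow.trans (sum_le_sum fun i _ => h (d i))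
  · exact hhigh.trans (sum_le_sum fun i _ => h (d i))

theorem choose_add_choose_le_sum_natAbs_sub {n a b : ℕ} (hab : b ≤ a) (han : a ≤ b + n) (k : ℤ) :
    (a + 1).choose 2 + (b + 1).choose 2 ≤
      ∑ i ∈ range (a + b + 1), ((i : ℤ) - b - k * n).natAbs := by
  simp only [sub_sub]
  rw [← sum_natAbs_sub_natCast]
  apply sum_natAbs_sub_le_sum_natAbs_sub
  push_cast
  rcases le_or_gt k 0 with hk | hk
  · have : k * (n : ℤ) ≤ 0 := mul_nonpos_of_nonpos_of_nonneg hk (by omega)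
    omega
  · have : (n : ℤ) ≤ k * n := le_mul_of_one_le_left (by omega) hk
    omega

theorem sum_range_ite_pred {M : Type*} [AddCommMonoid M] (f : ℕ → M) (p r : ℕ) :
    ∑ i ∈ range (p + r + 1), f (if i ≤ p then i else i - 1) =
      ∑ i ∈ range (p + r), f i + f p := by
  have hfirst : ∑ i ∈ range (p + 1), f (if i ≤ p then i else i - 1) = ∑ i ∈ range (p + 1), f i :=
    sum_congr rfl fun i hi => by rw [if_pos (Nat.lt_succ_iff.1 (mem_range.1 hi))]
  have hlast : ∀ i, f (if p + 1 + i ≤ p then p + 1 + i else p + 1 + i - 1) = f (p + i) := by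
    intro i
    rw [if_neg (by omega), add_right_comm, Nat.add_sub_cancel]
  rw [add_right_comm, sum_range_add, hfirst, sum_range_succ, sum_range_add, add_right_comm]
  simp only [hlast]

namespace yokeGraph

variable {n m a b : ℕ}

/-- The extremal sequence takes the values `⌊n / 2⌋` and `⌈n / 2⌉`, as far as possible from the
multiples of `n`; written as differences of `⌊n i / 2⌋`, its sum telescopes. -/
theorem diam_of_le (hn : 1 ≤ n) (hmn : m ≤ n) : (yokeGraph n m).diam = n * (m + 1) / 2 := by
  let x : ℕ → ℤ := fun i => n * i / 2
  have hsum : ∑ i ∈ range (m + 1), (x (i + 1) - x i) = n * (m + 1) / 2 := by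
    rw [sum_range_sub]
    simp [x]
  refine diam_eq (d := fun i => x (i + 1) - x i) (fun d hd => ?_) (fun i _ => ?_)
    (le_sum_natAbs_sub_mul ?_ ?_)
  · refine HasUnitSteps.exists_sum_natAbs_sub_le (a := m) (b := 0) hd hn (Nat.zero_le m) ?_ ?_
    · rw [Nat.le_div_iff_mul_le two_pos, Nat.choose_eq_zero_of_lt (n := 0 + 1) (by omega), add_zero]
      have hchoose := two_mul_choose_two (m + 1)
      have hmul := Nat.mul_le_mul_right (m + 1) hmn
      zify at hmul ⊢
      push_cast at hchoose
      linarith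
    · rw [Nat.choose_zero_succ, add_zero]
      omega
  · simp only [x]
    push_cast
    simp only [mul_add, mul_one]
    omega
  · rw [hsum]
    push_cast
    rfl
  · rw [sum_sub_distrib, hsum, sum_const, card_range, nsmul_eq_mul, mul_comm (_ : ℤ) (n : ℤ)]
    push_cast
    omega

theorem diam_eq_choose_add_choose (hn : 1 ≤ n) (h : a = b + n ∨ a + 1 = b + n ∧ n / 2 ≤ b) :
    (yokeGraph n (a + b)).diam = (a + 1).choose 2 + (b + 1).choose 2 := by
  refine diam_eq (fun d hd => hd.exists_sum_natAbs_sub_le hn (by omega) le_rfl ?_)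
    (d := fun i => (i : ℤ) - b) (fun i _ => by simp)
    (choose_add_choose_le_sum_natAbs_sub (by omega) (by omega))
  have ha := two_mul_choose_two (a + 1)
  have hb := two_mul_choose_two (b + 1)
  have hb_pred := two_mul_choose_two b
  zify
  push_cast at ha hb
  rcases h with rfl | ⟨h, hnb⟩
  · push_cast at ha ⊢
    linarith
  · obtain ⟨c, rfl⟩ : ∃ c, n = c + 1 := ⟨n - 1, by omega⟩
    obtain rfl : a = b + c := by omega
    have hcb : (c : ℤ) ≤ 2 * b := by omega
    push_cast at ha ⊢
    linarith

/-- The extremal sequence runs through `-b, …, a` with the middle value `⌊n / 2⌋` repeated. -/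
theorem diam_eq_choose_add_choose_add_half (hab : a = b + n) (hb : b + 1 ≤ n / 2) :
    (yokeGraph n (a + b + 1)).diam = (a + 1).choose 2 + (b + 1).choose 2 + n / 2 := by
  refine diam_eq (d := fun i => ((if i ≤ b + n / 2 then i else i - 1 : ℕ) : ℤ) - b)
    (fun d hd => ?_) (fun i _ => ?_) fun k => ?_
  · have hchoose := choose_two_succ (b + 1)
    refine HasUnitSteps.exists_sum_natAbs_sub_le (a := a) (b := b + 1) hd (by omega)
      (by omega) (by omega) ?_
    have ha2 := two_mul_choose_two (a + 1)
    have hb2 := two_mul_choose_two (b + 1)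
    have hhalf : n ≤ 2 * (n / 2) + 1 := by omega
    subst hab
    zify at hhalf ⊢
    push_cast at ha2 hb2 ⊢
    linarith
  · dsimp only
    split_ifs <;> omega
  · obtain ⟨r, hr⟩ : ∃ r, a + b + 1 = b + n / 2 + r := ⟨a + 1 - n / 2, by omega⟩
    have hmid : n / 2 ≤ (((b + n / 2 : ℕ) : ℤ) - b - k * n).natAbs := by
      rw [Nat.cast_add, add_sub_cancel_left]
      rcases le_natAbs_sub_mul_or n k with h | h
      all_goals
        have := h (n / 2 : ℕ)
        omega
    rw [hr, sum_range_ite_pred (fun j => ((j : ℤ) - b - k * n).natAbs), ← hr]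
    exact add_le_add (choose_add_choose_le_sum_natAbs_sub (by omega) hab.le k) hmid

theorem diam_one (m : ℕ) :
    (yokeGraph 1 m).diam = (m ⌈/⌉ 2 + 1).choose 2 + (m / 2 + 1).choose 2 := by
  rw [Nat.ceilDiv_eq_add_pred_div]
  have hdiam := diam_eq_choose_add_choose (n := 1) (a := (m + 2 - 1) / 2) (b := m / 2) le_rfl
    (by omega)
  rwa [show (m + 2 - 1) / 2 + m / 2 = m by omega] at hdiam

theorem diam_of_two_dvd_or_le (hn : 1 ≤ n) (hnm : n ≤ m)
    (h : 2 ∣ m - n ∨ n ≤ (m + 1) ⌈/⌉ 2) :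
    (yokeGraph n m).diam = ((m + n) / 2 + 1).choose 2 + ((m - n) ⌈/⌉ 2 + 1).choose 2 := by
  rw [Nat.ceilDiv_eq_add_pred_div] at h ⊢
  have hdiam := diam_eq_choose_add_choose (a := (m + n) / 2) (b := (m - n + 2 - 1) / 2) hn
    (by omega)
  rwa [show (m + n) / 2 + (m - n + 2 - 1) / 2 = m by omega] at hdiam

theorem diam_of_not_two_dvd_or_le (hnm : n ≤ m)
    (h : ¬ (2 ∣ m - n ∨ n ≤ (m + 1) ⌈/⌉ 2)) :
    (yokeGraph n m).diam = ((m + n) / 2 + 1).choose 2 + ((m - n) ⌈/⌉ 2 + 1).choose 2 +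
      (n - (m + 1) ⌈/⌉ 2) := by
  simp only [Nat.ceilDiv_eq_add_pred_div] at h ⊢
  obtain ⟨b, hb⟩ : ∃ b, (m - n + 2 - 1) / 2 = b + 1 := ⟨(m - n - 1) / 2, by omega⟩
  have hdiam := diam_eq_choose_add_choose_add_half (n := n) (a := (m + n) / 2) (b := b)
    (by omega) (by omega)
  rw [show (m + n) / 2 + b + 1 = m by omega] at hdiam
  rw [hdiam, hb, choose_two_succ (b + 1)]
  omega

end yokeGraph

theorem mainTheorem1 (n m : ℕ) (hn : 1 ≤ n) :
    (yokeGraph n m).Connected ∧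
    (n = 1 →
      (yokeGraph n m).diam = (m ⌈/⌉ 2 + 1).choose 2 + (m / 2 + 1).choose 2) ∧
    (m ≤ n → (yokeGraph n m).diam = n * (m + 1) / 2) ∧
    (2 ≤ n → n ≤ m →
      ∀ d₀ : ℕ, d₀ = ((m + n) / 2 + 1).choose 2 + ((m - n) ⌈/⌉ 2 + 1).choose 2 →
      ((2 ∣ m - n ∨ n ≤ (m + 1) ⌈/⌉ 2) → (yokeGraph n m).diam = d₀) ∧
      (¬ (2 ∣ m - n ∨ n ≤ (m + 1) ⌈/⌉ 2) →
        (yokeGraph n m).diam = d₀ + (n - (m + 1) ⌈/⌉ 2))) := by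
  refine ⟨yokeGraph.connected n m, ?_, yokeGraph.diam_of_le hn, ?_⟩
  · rintro rfl
    exact yokeGraph.diam_one m
  · rintro - hnm d₀ rfl
    exact ⟨yokeGraph.diam_of_two_dvd_or_le hn hnm, yokeGraph.diam_of_not_two_dvd_or_le hnm⟩
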